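/- Throughout, universes \(X\) are finite and non-empty, \(\mathcal P(X)\) is the power set of \(X\) and \(\widetilde{\mathcal P}(X)=[0,1]^X\) is the set of fuzzy sets on \(X\). An \(n\)-ary semi-fuzzy quantifier on \(X\) is a map \(Q:\mathcal P(X)^n\to[0,1]\), an \(n\)-ary fuzzy quantifier on \(X\) is a map \(\widetilde Q:\widetilde{\mathcal P}(X)^n\to[0,1]\) (\(n\ge 0\)). A quantifier fuzzification mechanism (QFM) \(\mathcal F\) assigns to each \(n\)-ary semi-fuzzy quantifier \(Q\) on each \(X\) an \(n\)-ary fuzzy quantifier \(\mathcal F(Q)\) on \(X\). A QFM \(\mathcal F\) induces for every \(f:\{0,1\}^n\to[0,1]\) (\(n\ge1\)) the map \(\widetilde f:[0,1]^n\to[0,1]\), \(\widetilde f(x_1,\dots,x_n)=\mathcal F(Q_f)(k\mapsto x_k)\), where \(Q_f\) is the unary semi-fuzzy quantifier on \(\{1,\dots,n\}\) with \(Q_f(S)=f(\mathbf 1_S(1),\dots,\mathbf 1_S(n))\). Applying this to the Boolean connectives gives \(\widetilde\lnot,\widetilde\lor,\widetilde\rightarrow\), which are extended pointwise to fuzzy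 sets (complement \(\widetilde\lnot\), union \(\widetilde\cup\), implication \(\widetilde\rightarrow\)). For \(f:X\to Y\), \(\mathcal F\) induces \(\widehat{\mathcal F}(f):\widetilde{\mathcal P}(X)\to\widetilde{\mathcal P}(Y)\), \(\widehat{\mathcal F}(f)(A)(y)=\mathcal F\big(S\mapsto \mathbf 1_{f(S)}(y)\big)(A)\). \(\mathcal F\) is a determiner fuzzification scheme (DFS) if for all \(X\), \(n\) and \(Q:\mathcal P(X)^n\to[0,1]\): (1) if \(n\le1\), then \(\mathcal F(Q)\) agrees with \(Q\) on crisp sets; (2) for \(e\in X\), if \(Q(S)=\mathbf 1_S(e)\) for all \(S\in\mathcal P(X)\), then \(\mathcal F(Q)(A)=A(e)\) for all \(A\in\widetilde{\mathcal P}(X)\); (3) for \(n\ge1\), \(\mathcal F\) sends \((S_1,\dots,S_n)\mapsto\widetilde\lnot Q(S_1,\dots,S_{n-1},X\setminus S_n)\) to \((A_1,\dots,A_n)\mapsto\widetilde\lnot\mathcal F(Q)(A_1,\dots,A_{n-1},\widetilde\lnot A_n)\); (4) for \(n\ge1\), \(\mathcal F\) sends \((S_1,\dots,S_{n+1})\mapsto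 Q(S_1,\dots,S_{n-1},S_n\cup S_{n+1})\) to \((A_1,\dots,A_{n+1})\mapsto\mathcal F(Q)(A_1,\dots,A_{n-1},A_n\widetilde\cup A_{n+1})\); (5) for \(n\ge1\), if \(Q\) is non-increasing in its last argument, so is \(\mathcal F(Q)\); (6) for all \(Y\) and \(f_1,\dots,f_n:Y\to X\), \(\mathcal F\) sends \((S_1,\dots,S_n)\mapsto Q(f_1(S_1),\dots,f_n(S_n))\) to \((A_1,\dots,A_n)\mapsto\mathcal F(Q)(\widehat{\mathcal F}(f_1)(A_1),\dots,\widehat{\mathcal F}(f_n)(A_n))\). For \(n\ge1\), an \(n\)-ary semi-fuzzy quantifier \(Q\) and an \(n\)-ary fuzzy quantifier \(\widetilde Q\) on \(X\), define the \((n+1)\)-ary quantifiers \[(Q{\rightarrow})(S_1,\dots,S_{n+1})=Q(S_1,\dots,S_{n-1},(X\setminus S_n)\cup S_{n+1}),\qquad(\widetilde Q\,\widetilde\rightarrow)(A_1,\dots,A_{n+1})=\widetilde Q(A_1,\dots,A_{n-1},A_n\widetilde\rightarrow A_{n+1}).\] **Theorem.** Let \(\mathcal F\) be a DFS. For every \(X\),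 every \(n\ge1\) and every \(n\)-ary semi-fuzzy quantifier \(Q\) on \(X\), \[\mathcal F(Q{\rightarrow})=\mathcal F(Q)\,\widetilde\rightarrow .\] In particular, let \(\Lambda:[0,1]\to[0,1]\) be non-decreasing with \(\Lambda(0)=0\) and \(\Lambda(1)=1\), and put \(Q_\Lambda(S)=\Lambda(|S|/|X|)\) and \(Q_\Lambda^{\rightarrow}(S,T)=\Lambda(|(X\setminus S)\cup T|/|X|)\). Then \(\mathcal F(Q_\Lambda^{\rightarrow})(A,B)=\mathcal F(Q_\Lambda)(A\,\widetilde\rightarrow\,B)\) for all \(A,B\in\widetilde{\mathcal P}(X)\). -/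

import Mathlib

open scoped unitInterval

universe u

noncomputable section

/-! ### Fuzzy sets and quantifiers -/

/-- A fuzzy subset of `X` (ordered pointwise, i.e. by fuzzy inclusion). -/
abbrev FuzzySet (X : Type*) := X → I

/-- An `n`-ary semi-fuzzy quantifier on `X`: crisp arguments, gradual result. -/
abbrev SemiFuzzyQuantifier (X : Type*) (n : ℕ) := (Fin n → Set X) → I

/-- An `n`-ary fuzzy quantifier on `X`: fuzzy arguments, gradual result. -/
abbrev FuzzyQuantifier (X : Type*) (n : ℕ) := (Fin n → FuzzySet X) → I

/-- The truth value of a two-valued proposition. -/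
def truthValue (p : Prop) : I := by
  classical exact if p then 1 else 0

/-- A crisp set viewed as a fuzzy set. -/
def crisp {X : Type*} (S : Set X) : FuzzySet X := fun x => truthValue (x ∈ S)

/-- The underlying semi-fuzzy quantifier of a fuzzy quantifier. -/
def FuzzyQuantifier.underlying {X : Type*} {n : ℕ} (Q : FuzzyQuantifier X n) :
    SemiFuzzyQuantifier X n :=
  fun S => Q (fun i => crisp (S i))

/-- A quantifier fuzzification mechanism: to every semi-fuzzy quantifier, of any arity and on any
finite non-empty universe, it assigns a fuzzy quantifier of the same arity on the same universe. -/
structure QFM where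
  fuzzify : ∀ {X : Type u} [Finite X] [Nonempty X] {n : ℕ},
    SemiFuzzyQuantifier X n → FuzzyQuantifier X n

/-! ### Operations on the argument lists of quantifiers, for crisp and fuzzy sets alike -/

/-- `(a₁, …, aₙ, aₙ₊₁) ↦ (a₁, …, aₙ, g aₙ₊₁)`. -/
def mapLast {α : Type*} (g : α → α) {n : ℕ} (a : Fin (n + 1) → α) : Fin (n + 1) → α :=
  Function.update a (Fin.last n) (g (a (Fin.last n)))

/-- `(a₁, …, aₙ, aₙ₊₁, aₙ₊₂) ↦ (a₁, …, aₙ, op aₙ₊₁ aₙ₊₂)`. -/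
def mergeLast {α : Type*} (op : α → α → α) {n : ℕ} (a : Fin (n + 2) → α) : Fin (n + 1) → α :=
  Fin.snoc (α := fun _ => α) (fun i : Fin n => a i.castSucc.castSucc)
    (op (a (Fin.last n).castSucc) (a (Fin.last (n + 1))))

/-- `q` is non-increasing in its last argument. -/
def NonincreasingInLast {α : Type*} [LE α] {n : ℕ} (q : (Fin (n + 1) → α) → I) : Prop :=
  ∀ (a : Fin (n + 1) → α) (b : α), a (Fin.last n) ≤ b → q (Function.update a (Fin.last n) b) ≤ q a

/-! ### The propositional logic induced by a QFM -/

namespace QFM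

/-- The semi-fuzzy quantifier on `{1, …, n}` that corresponds to the semi-fuzzy truth function `f`
under the identification of `{0,1}ⁿ` with the power set of `{1, …, n}`. -/
def truthQuantifier {n : ℕ} (f : (Fin n → Prop) → I) :
    SemiFuzzyQuantifier (ULift.{u} (Fin n)) 1 :=
  fun S => f (fun k => ULift.up k ∈ S 0)

/-- The fuzzy truth function `[0,1]ⁿ → [0,1]` that the QFM induces from the semi-fuzzy truth
function `f : {0,1}ⁿ → [0,1]`, where `n ≥ 1`. -/
def inducedTruth (F : QFM.{u}) {n : ℕ} [NeZero n] (f : (Fin n → Prop) → I) (x : Fin n → I) : I :=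
  F.fuzzify (truthQuantifier.{u} f) (fun _ k => x k.down)

/-- The induced negation. -/
def neg (F : QFM.{u}) (x : I) : I :=
  F.inducedTruth (fun p : Fin 1 → Prop => truthValue (¬ p 0)) ![x]

/-- The induced disjunction. -/
def disj (F : QFM.{u}) (x y : I) : I :=
  F.inducedTruth (fun p : Fin 2 → Prop => truthValue (p 0 ∨ p 1)) ![x, y]

/-- The induced implication. -/
def imp (F : QFM.{u}) (x y : I) : I :=
  F.inducedTruth (fun p : Fin 2 → Prop => truthValue (p 0 → p 1)) ![x, y]

/-- The induced fuzzy complement. -/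
def compl (F : QFM.{u}) {X : Type*} (A : FuzzySet X) : FuzzySet X := fun x => F.neg (A x)

/-- The induced fuzzy union. -/
def union (F : QFM.{u}) {X : Type*} (A B : FuzzySet X) : FuzzySet X :=
  fun x => F.disj (A x) (B x)

/-- The induced implication of fuzzy sets. -/
def impSet (F : QFM.{u}) {X : Type*} (A B : FuzzySet X) : FuzzySet X :=
  fun x => F.imp (A x) (B x)

/-- The extension principle induced by the QFM: the membership grade of `y` in the image of `A`
under `f` is obtained by fuzzifying the crisp quantifier `S ↦ [y ∈ f(S)]`. -/
def image (F : QFM.{u}) {X Y : Type u} [Finite X] [Nonempty X] (f : X → Y) (A : FuzzySet X) :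
    FuzzySet Y :=
  fun y => F.fuzzify (fun S : Fin 1 → Set X => truthValue (y ∈ f '' S 0)) (fun _ => A)

end QFM

/-! ### Determiner fuzzification schemes -/

/-- A determiner fuzzification scheme in the sense of Glöckner. -/
structure QFM.IsDFS (F : QFM.{u}) : Prop where
  /-- Correct generalization of nullary and unary quantifiers. -/
  correct_generalization : ∀ {X : Type u} [Finite X] [Nonempty X] {n : ℕ}, n ≤ 1 →
    ∀ Q : SemiFuzzyQuantifier X n, (F.fuzzify Q).underlying = Q
  /-- The crisp projection quantifier `S ↦ [e ∈ S]` is sent to the fuzzy one, `A ↦ A(e)`. -/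
  projection : ∀ {X : Type u} [Finite X] [Nonempty X] (e : X),
    F.fuzzify (fun S : Fin 1 → Set X => truthValue (e ∈ S 0)) = fun A => A 0 e
  /-- Compatibility with dualization (external and internal negation together). -/
  dualization : ∀ {X : Type u} [Finite X] [Nonempty X] {n : ℕ}
    (Q : SemiFuzzyQuantifier X (n + 1)),
    F.fuzzify (fun S => F.neg (Q (mapLast (fun T => Tᶜ) S))) =
      fun A => F.neg (F.fuzzify Q (mapLast F.compl A))
  /-- Compatibility with internal joins. -/
  internal_joins : ∀ {X : Type u} [Finite X] [Nonempty X] {n : ℕ}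
    (Q : SemiFuzzyQuantifier X (n + 1)),
    F.fuzzify (fun S => Q (mergeLast (fun T U => T ∪ U) S)) =
      fun A => F.fuzzify Q (mergeLast F.union A)
  /-- Preservation of monotonicity. -/
  preservation_of_monotonicity : ∀ {X : Type u} [Finite X] [Nonempty X] {n : ℕ}
    (Q : SemiFuzzyQuantifier X (n + 1)),
    NonincreasingInLast Q → NonincreasingInLast (F.fuzzify Q)
  /-- Compatibility with functional application. -/
  functional_application : ∀ {X Y : Type u} [Finite X] [Nonempty X] [Finite Y] [Nonempty Y]
    {n : ℕ} (Q : SemiFuzzyQuantifier Y n) (f : Fin n → X → Y),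
    F.fuzzify (fun S : Fin n → Set X => Q (fun i => f i '' S i)) =
      fun A => F.fuzzify Q (fun i => F.image (f i) (A i))

/-! ### Implicative quantifiers -/

/-- The semi-fuzzy quantifier `Q→`, i.e. `Q→(S₁, …, Sₙ₊₁) = Q(S₁, …, Sₙ₋₁, Sₙ → Sₙ₊₁)` with the
crisp implication `S → T = Sᶜ ∪ T`; the arity of `Q` is at least one. -/
def SemiFuzzyQuantifier.implicative {X : Type*} {n : ℕ} (Q : SemiFuzzyQuantifier X (n + 1)) :
    SemiFuzzyQuantifier X (n + 2) :=
  fun S => Q (mergeLast (fun T U => Tᶜ ∪ U) S)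

/-- The fuzzy quantifier `Q→̃`, formed with the implication induced by the QFM `F`. -/
def FuzzyQuantifier.implicative (F : QFM.{u}) {X : Type*} {n : ℕ}
    (Q : FuzzyQuantifier X (n + 1)) : FuzzyQuantifier X (n + 2) :=
  fun A => Q (mergeLast F.impSet A)

/-- A regular increasing monotone quantifier. -/
structure IsRIM (Λ : I → I) : Prop where
  mono : Monotone Λ
  map_zero : Λ 0 = 0
  map_one : Λ 1 = 1

/-- The proportion `|S| / |X|` of a subset of a finite universe. -/
def proportion {X : Type*} [Finite X] (S : Set X) : I :=
  ⟨(S.ncard : ℝ) / (Nat.card X : ℝ), by positivity,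
    div_le_one_of_le₀ (by exact_mod_cast Set.ncard_le_card S) (by positivity)⟩

/-- The unary proportional quantifier `S ↦ Λ(|S| / |X|)`. -/
def unaryProportional (X : Type*) [Finite X] (Λ : I → I) : SemiFuzzyQuantifier X 1 :=
  fun S => Λ (proportion (S 0))

/-- The binary quantifier `(S, T) ↦ Λ(|S → T| / |X|)` with `S → T = Sᶜ ∪ T`. -/
def implicativeProportional (X : Type*) [Finite X] (Λ : I → I) : SemiFuzzyQuantifier X 2 :=
  fun S => Λ (proportion ((S 0)ᶜ ∪ S 1))

end

/-! The axioms handle complements only in the last argument, and only tied to an external negation,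
so the proof frees them from both restrictions. The main device is the disjoint union `X ⊕ X`:
pushing two arguments forward along `Sum.inl` and `Sum.inr` and joining them encodes the pair as the
single fuzzy set `Sum.elim a b` (`fuzzify_sum`). Exchanging the last two arguments is then
functional application of `Sum.swap` (`fuzzify_swapLast`), and an empty vacuous argument can be
dropped; monotonicity extends this to any vacuous argument (`fuzzify_dropLast`). Dualizing in a
vacuous argument yields external negation alone (`fuzzify_neg`), and cancelling it from dualization
yields complementation alone (`fuzzify_compl_last`). With exchange and internal joins, `Q→` becomes
`F.fuzzify Q` applied to the union of the complement of `a` with `b`. Evaluating one such quantifier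
on a one-point universe in two ways identifies the induced implication with `F.disj (F.neg x) y`. -/

/-! ### Lists of arguments -/

section Arguments

variable {α : Type*} {n : ℕ}

/-- The list `(p₁, …, pₙ, a)`. -/
def appendOne (p : Fin n → α) (a : α) : Fin (n + 1) → α := Fin.snoc (α := fun _ => α) p a

/-- The list without its last entry. -/
def dropLast (p : Fin (n + 1) → α) : Fin n → α := fun i => p i.castSucc

/-- The list with its last two entries exchanged. -/
def swapLast (p : Fin (n + 2) → α) : Fin (n + 2) → α :=
  appendOne (appendOne (dropLast (dropLast p)) (p (Fin.last _))) (p (Fin.last n).castSucc)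

@[simp] theorem appendOne_last (p : Fin n → α) (a : α) : appendOne p a (Fin.last n) = a := by
  simp [appendOne]

@[simp] theorem appendOne_castSucc (p : Fin n → α) (a : α) (i : Fin n) :
    appendOne p a i.castSucc = p i := by
  simp [appendOne]

@[simp] theorem dropLast_appendOne (p : Fin n → α) (a : α) : dropLast (appendOne p a) = p := by
  funext i; simp [dropLast]

theorem exists_appendOne (p : Fin (n + 1) → α) : ∃ q a, p = appendOne q a :=
  ⟨dropLast p, p (Fin.last n), by
    funext i; refine Fin.lastCases ?_ (fun i => ?_) i <;> simp [dropLast]⟩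

theorem exists_appendOne_appendOne (p : Fin (n + 2) → α) :
    ∃ q a b, p = appendOne (appendOne q a) b := by
  obtain ⟨q, b, rfl⟩ := exists_appendOne p
  obtain ⟨q, a, rfl⟩ := exists_appendOne q
  exact ⟨q, a, b, rfl⟩

theorem map_appendOne {β : Type*} (g : α → β) (p : Fin n → α) (a : α) :
    (fun i => g (appendOne p a i)) = appendOne (fun i => g (p i)) (g a) := by
  funext i; refine Fin.lastCases ?_ (fun i => ?_) i <;> simp

@[simp] theorem update_appendOne (p : Fin n → α) (a b : α) :
    Function.update (appendOne p a) (Fin.last n) b = appendOne p b := by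
  funext i
  refine Fin.lastCases ?_ (fun i => ?_) i
  · simp
  · simp

@[simp] theorem mapLast_appendOne (g : α → α) (p : Fin n → α) (a : α) :
    mapLast g (appendOne p a) = appendOne p (g a) := by
  simp [mapLast]

@[simp] theorem mergeLast_appendOne (op : α → α → α) (p : Fin n → α) (a b : α) :
    mergeLast op (appendOne (appendOne p a) b) = appendOne p (op a b) := by
  simp [mergeLast, appendOne]

@[simp] theorem swapLast_appendOne (p : Fin n → α) (a b : α) :
    swapLast (appendOne (appendOne p a) b) = appendOne (appendOne p b) a := by
  simp [swapLast]

theorem appendOne_zero (p : Fin 0 → α) (a : α) : appendOne p a = fun _ => a := by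
  funext i
  refine Fin.lastCases ?_ (fun i => i.elim0) i
  exact appendOne_last p a

theorem appendOne_appendOne_zero (p : Fin 0 → α) (a b : α) :
    appendOne (appendOne p a) b = ![a, b] := by
  funext i
  refine Fin.lastCases ?_ (fun i => ?_) i
  · rw [appendOne_last]
    rfl
  · rw [appendOne_castSucc, appendOne_zero]
    match i with
    | 0 => rfl

end Arguments

@[simp] theorem truthValue_true : truthValue True = 1 := by simp [truthValue]

@[simp] theorem truthValue_false : truthValue False = 0 := by simp [truthValue]

theorem crisp_empty {X : Type*} : crisp (∅ : Set X) = ⊥ := by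
  funext x
  simp [crisp]
  rfl

theorem crisp_univ {X : Type*} : crisp (Set.univ : Set X) = ⊤ := by
  funext x
  simp [crisp]
  rfl

namespace QFM.IsDFS

variable {F : QFM.{u}} {X Y : Type u} [Finite X] [Nonempty X] {n : ℕ}

/-! ### Unary quantifiers and the induced negation -/

theorem fuzzify_crisp (hF : F.IsDFS) (Q : SemiFuzzyQuantifier X 1) (S : Set X) :
    F.fuzzify Q (fun _ => crisp S) = Q (fun _ => S) :=
  congr_fun (hF.correct_generalization le_rfl Q) (fun _ => S)

theorem fuzzify_projection (hF : F.IsDFS) (e : X) (A : Fin 1 → FuzzySet X) :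
    F.fuzzify (fun S : Fin 1 → Set X => truthValue (e ∈ S 0)) A = A 0 e :=
  congr_fun (hF.projection e) A

theorem fuzzify_antitone (hF : F.IsDFS) (Q : SemiFuzzyQuantifier X (n + 1))
    (hQ : NonincreasingInLast Q) (p : Fin n → FuzzySet X) {a b : FuzzySet X} (hab : a ≤ b) :
    F.fuzzify Q (appendOne p b) ≤ F.fuzzify Q (appendOne p a) := by
  simpa using hF.preservation_of_monotonicity Q hQ (appendOne p a) b (by simpa using hab)

/-- The value is squeezed by monotonicity between those at the crisp sets `⊥` and `⊤`, where correct
generalization gives `c`. -/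
theorem fuzzify_const (hF : F.IsDFS) (c : I) (A : Fin 1 → FuzzySet X) :
    F.fuzzify (fun _ : Fin 1 → Set X => c) A = c := by
  obtain ⟨p, a, rfl⟩ := exists_appendOne A
  have hmono := fun {a b : FuzzySet X} => hF.fuzzify_antitone
    (fun _ : Fin 1 → Set X => c) (fun _ _ _ => le_rfl) p (a := a) (b := b)
  have h0 := hF.fuzzify_crisp (fun _ : Fin 1 → Set X => c) ∅
  have h1 := hF.fuzzify_crisp (fun _ : Fin 1 → Set X => c) Set.univ
  rw [crisp_empty, ← appendOne_zero p] at h0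
  rw [crisp_univ, ← appendOne_zero p] at h1
  exact le_antisymm ((hmono bot_le).trans h0.le) (h1.ge.trans (hmono le_top))

theorem neg_truthValue (hF : F.IsDFS) (p : Prop) : F.neg (truthValue p) = truthValue (¬ p) := by
  have h := hF.fuzzify_crisp
    (truthQuantifier.{u} fun q : Fin 1 → Prop => truthValue (¬ q 0)) {_k | p}
  simp only [truthQuantifier, Set.mem_ofPred_eq] at h
  rw [← h, neg, inducedTruth]
  congr 1
  funext _ k
  rw [Subsingleton.elim k (ULift.up 0)]
  simp [crisp]

/-- The projection quantifier on a one-point universe is its own dual, so dualization returns `x`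
itself. -/
theorem neg_neg (hF : F.IsDFS) (x : I) : F.neg (F.neg x) = x := by
  have h := congr_fun (hF.dualization
    (fun S : Fin 1 → Set PUnit.{u + 1} => truthValue (PUnit.unit ∈ S 0))) (fun _ _ => x)
  have e : (fun S : Fin 1 → Set PUnit.{u + 1} =>
      F.neg (truthValue (PUnit.unit ∈ mapLast (fun T => Tᶜ) S 0))) =
      fun S => truthValue (PUnit.unit ∈ S 0) := by
    funext S
    rw [hF.neg_truthValue]
    simp [mapLast]
  rw [e, hF.fuzzify_projection, hF.fuzzify_projection] at h
  simpa [mapLast, compl] using h.symm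

theorem compl_bot {X : Type*} (hF : F.IsDFS) : F.compl (⊥ : FuzzySet X) = ⊤ := by
  funext x
  have h := hF.neg_truthValue False
  rw [not_false_eq_true, truthValue_true, truthValue_false] at h
  exact h

/-! ### Images and unions of fuzzy sets -/

/-- For injective `f`, the quantifier defining the image at `f x` is the projection at `x`. -/
theorem image_apply_of_injective (hF : F.IsDFS) {f : X → Y} (hf : f.Injective) (A : FuzzySet X)
    (x : X) : F.image f A (f x) = A x := by
  simp only [image, hf.mem_set_image]
  exact hF.fuzzify_projection x _

theorem image_apply_of_notMem_range (hF : F.IsDFS) {f : X → Y} (A : FuzzySet X) {y : Y}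
    (hy : y ∉ Set.range f) : F.image f A y = 0 := by
  have h : ∀ S : Set X, (y ∈ f '' S) = False := fun S =>
    eq_false fun h => hy (Set.image_subset_range f S h)
  simp only [image, h, truthValue_false]
  exact hF.fuzzify_const 0 _

theorem image_id (hF : F.IsDFS) (A : FuzzySet X) : F.image id A = A := by
  funext x
  exact hF.image_apply_of_injective Function.injective_id A x

/-- Compatibility with functional application, the same function being applied to all arguments. -/
theorem fuzzify_image [Finite Y] [Nonempty Y] (hF : F.IsDFS) (Q : SemiFuzzyQuantifier Y n)
    (f : X → Y) (A : Fin n → FuzzySet X) :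
    F.fuzzify (fun S => Q (fun i => f '' S i)) A = F.fuzzify Q (fun i => F.image f (A i)) :=
  congr_fun (hF.functional_application Q fun _ => f) A

/-- Zero is neutral for the induced disjunction: including a point as the `i`-th of two turns the
disjunction quantifier into a projection, and the image of the grade `x` is `x` at `i` and `0`
elsewhere. -/
theorem disj_eq (hF : F.IsDFS) (i : Fin 2) (x : I) (z : Fin 2 → I) (hz : z i = x)
    (hz' : ∀ j, j ≠ i → z j = 0) : F.disj (z 0) (z 1) = x := by
  let f : PUnit.{u + 1} → ULift.{u} (Fin 2) := fun _ => ULift.up i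
  let Q : SemiFuzzyQuantifier (ULift.{u} (Fin 2)) 1 :=
    truthQuantifier.{u} fun p : Fin 2 → Prop => truthValue (p 0 ∨ p 1)
  have hf : f.Injective := fun _ _ _ => rfl
  have h := hF.fuzzify_image Q f (fun _ _ => x)
  have e : (fun S : Fin 1 → Set PUnit.{u + 1} => Q (fun i => f '' S i)) =
      fun S => truthValue (PUnit.unit ∈ S 0) := by
    funext S
    fin_cases i <;> simp [Q, f, truthQuantifier, Unique.exists_iff]
  rw [e, hF.fuzzify_projection] at h
  rw [h, disj, inducedTruth]
  congr 1
  funext _ k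
  by_cases hk : k.down = i
  · obtain rfl : k = f PUnit.unit := ULift.ext _ _ hk
    refine Eq.trans ?_ (hF.image_apply_of_injective hf _ PUnit.unit).symm
    rw [← hz]
    fin_cases i <;> rfl
  · rw [hF.image_apply_of_notMem_range]
    · obtain ⟨k⟩ := k
      have := hz' k hk
      fin_cases k <;> exact this
    · rintro ⟨_, rfl⟩
      exact hk rfl

theorem zero_disj (hF : F.IsDFS) (x : I) : F.disj 0 x = x :=
  hF.disj_eq 1 x ![0, x] rfl fun j hj => by fin_cases j <;> simp_all

theorem disj_zero (hF : F.IsDFS) (x : I) : F.disj x 0 = x :=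
  hF.disj_eq 0 x ![x, 0] rfl fun j hj => by fin_cases j <;> simp_all

theorem union_image_inl_inr (hF : F.IsDFS) (a b : FuzzySet X) :
    F.union (F.image (Sum.inl : X → X ⊕ X) a) (F.image (Sum.inr : X → X ⊕ X) b) =
      Sum.elim a b := by
  funext y
  rcases y with x | x
  · simp only [union, Sum.elim_inl]
    rw [hF.image_apply_of_injective Sum.inl_injective,
      hF.image_apply_of_notMem_range b (by simp), hF.disj_zero]
  · simp only [union, Sum.elim_inr]
    rw [hF.image_apply_of_injective Sum.inr_injective,
      hF.image_apply_of_notMem_range a (by simp), hF.zero_disj]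

/-! ### The last two arguments of a quantifier -/

/-- The last two arguments of a quantifier may be merged into one on a disjoint union. -/
theorem fuzzify_sum (hF : F.IsDFS) (R : SemiFuzzyQuantifier (X ⊕ X) (n + 1))
    (Q : SemiFuzzyQuantifier X (n + 2))
    (hQ : ∀ (p : Fin n → Set X) (S T : Set X), Q (appendOne (appendOne p S) T) =
      R (appendOne (fun i => Sum.inl '' p i) (Sum.inl '' S ∪ Sum.inr '' T)))
    (p : Fin n → FuzzySet X) (a b : FuzzySet X) :
    F.fuzzify Q (appendOne (appendOne p a) b) =
      F.fuzzify R (appendOne (fun i => F.image Sum.inl (p i)) (Sum.elim a b)) := by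
  let f : Fin (n + 2) → X → X ⊕ X := appendOne (fun _ => Sum.inl) Sum.inr
  let R' : SemiFuzzyQuantifier (X ⊕ X) (n + 2) := fun U => R (mergeLast (fun T U => T ∪ U) U)
  -- `Q` arises from `R` by an internal join followed by functional application, so both axioms
  -- apply in turn.
  have e : Q = fun S : Fin (n + 2) → Set X => R' (fun i => f i '' S i) := by
    funext S
    obtain ⟨p, S, T, rfl⟩ := exists_appendOne_appendOne S
    have : (fun i => f i '' appendOne (appendOne p S) T i) =
        appendOne (appendOne (fun i => Sum.inl '' p i) (Sum.inl '' S)) (Sum.inr '' T) := by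
      funext i
      refine Fin.lastCases ?_ (fun i => Fin.lastCases ?_ (fun i => ?_) i) i <;> simp [f]
    simp only [R', hQ, this, mergeLast_appendOne]
  have h : (fun i => F.image (f i) (appendOne (appendOne p a) b i)) =
      appendOne (appendOne (fun i => F.image Sum.inl (p i)) (F.image Sum.inl a))
        (F.image Sum.inr b) := by
    funext i
    refine Fin.lastCases ?_ (fun i => Fin.lastCases ?_ (fun i => ?_) i) i <;> simp [f]
  rw [e, hF.functional_application R' f, hF.internal_joins R]
  simp only [h, mergeLast_appendOne, hF.union_image_inl_inr]

/-- Compatibility with the exchange of the last two arguments. -/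
theorem fuzzify_swapLast (hF : F.IsDFS) (Q : SemiFuzzyQuantifier X (n + 2))
    (A : Fin (n + 2) → FuzzySet X) :
    F.fuzzify (fun S => Q (swapLast S)) A = F.fuzzify Q (swapLast A) := by
  obtain ⟨p, a, b, rfl⟩ := exists_appendOne_appendOne A
  -- `R` decodes the last argument into its left and right halves, and `f` exchanges these halves
  -- while fixing the other arguments.
  let R : SemiFuzzyQuantifier (X ⊕ X) (n + 1) := fun U =>
    Q (appendOne (fun i => Sum.inl ⁻¹' U i) (Sum.inr ⁻¹' U (Fin.last n)))
  let f : Fin (n + 1) → X ⊕ X → X ⊕ X := appendOne (fun _ => id) Sum.swap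
  have hinl : ∀ S T : Set X, (Sum.inl ⁻¹' (Sum.inl '' S ∪ Sum.inr '' T : Set (X ⊕ X))) = S :=
    fun S T => by ext; simp
  have hinr : ∀ S T : Set X, (Sum.inr ⁻¹' (Sum.inl '' S ∪ Sum.inr '' T : Set (X ⊕ X))) = T :=
    fun S T => by ext; simp
  have hR : ∀ (p : Fin n → Set X) (S T : Set X),
      R (appendOne (fun i => Sum.inl '' p i) (Sum.inl '' S ∪ Sum.inr '' T)) =
        Q (appendOne (appendOne p S) T) := fun p S T => by
    simp only [R, appendOne_last, hinr, map_appendOne (fun U : Set (X ⊕ X) => Sum.inl ⁻¹' U),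
      hinl, Set.preimage_image_eq _ Sum.inl_injective]
  have hf : ∀ (p : Fin n → Set X) (S T : Set X),
      (fun i => f i '' appendOne (fun i => Sum.inl '' p i) (Sum.inl '' S ∪ Sum.inr '' T) i) =
        appendOne (fun i => Sum.inl '' p i) (Sum.inl '' T ∪ Sum.inr '' S) := fun p S T => by
    funext i
    refine Fin.lastCases ?_ (fun i => ?_) i
    · simp [f, Set.image_union, Set.image_image, Set.union_comm]
    · simp [f]
  rw [swapLast_appendOne, hF.fuzzify_sum R Q fun p S T => (hR p S T).symm,
    hF.fuzzify_sum (fun U => R (fun i => f i '' U i)) _ fun p S T => by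
      simp only [hf, hR, swapLast_appendOne],
    hF.functional_application R f]
  refine congrArg (F.fuzzify R) ?_
  funext i
  refine Fin.lastCases ?_ (fun i => ?_) i
  · simp only [f, appendOne_last]
    funext y
    obtain ⟨y, rfl⟩ := Sum.swap_rightInverse.surjective y
    rw [hF.image_apply_of_injective Sum.swap_leftInverse.injective]
    rcases y with y | y <;> rfl
  · simp only [f, appendOne_castSucc, hF.image_id]

/-! ### Vacuous arguments -/

theorem fuzzify_dropLast_bot (hF : F.IsDFS) (Q : SemiFuzzyQuantifier X (n + 1))
    (A : Fin (n + 1) → FuzzySet X) :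
    F.fuzzify (fun S => Q (dropLast S)) (appendOne A ⊥) = F.fuzzify Q A := by
  obtain ⟨p, a, rfl⟩ := exists_appendOne A
  let R : SemiFuzzyQuantifier (X ⊕ X) (n + 1) := fun U => Q (fun i => Sum.inl ⁻¹' U i)
  have hinl : ∀ S T : Set X, (Sum.inl ⁻¹' (Sum.inl '' S ∪ Sum.inr '' T : Set (X ⊕ X))) = S :=
    fun S T => by ext; simp
  have e : Q = fun S => R (fun i => Sum.inl '' S i) := by
    funext S
    simp only [R, Set.preimage_image_eq _ Sum.inl_injective]
  rw [hF.fuzzify_sum R _ fun p S T => by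
    simp only [dropLast_appendOne, R, map_appendOne (fun U : Set (X ⊕ X) => Sum.inl ⁻¹' U),
      hinl, Set.preimage_image_eq _ Sum.inl_injective]]
  conv_rhs => rw [e]
  rw [hF.fuzzify_image R Sum.inl, map_appendOne (F.image Sum.inl)]
  -- What remains is that `Sum.elim a ⊥` is the image of `a` under `Sum.inl`.
  congr 2
  funext y
  rcases y with x | x
  · exact (hF.image_apply_of_injective Sum.inl_injective a x).symm
  · exact (hF.image_apply_of_notMem_range a (by simp)).symm

theorem fuzzify_dual (hF : F.IsDFS) (Q : SemiFuzzyQuantifier X (n + 1)) (p : Fin n → FuzzySet X)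
    (a : FuzzySet X) :
    F.fuzzify (fun S => F.neg (Q (mapLast (fun T => Tᶜ) S))) (appendOne p a) =
      F.neg (F.fuzzify Q (appendOne p (F.compl a))) := by
  rw [hF.dualization]
  simp only [mapLast_appendOne]

/-- Dualizing in each of the last two arguments in turn produces two external negations, which
cancel. This is how complements are reached before external negation is available on its own. -/
theorem fuzzify_compl_compl (hF : F.IsDFS) (Q : SemiFuzzyQuantifier X (n + 2))
    (hQ : ∀ (p : Fin n → Set X) (S T : Set X),
      Q (appendOne (appendOne p Sᶜ) Tᶜ) = Q (appendOne (appendOne p S) T))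
    (p : Fin n → FuzzySet X) (a b : FuzzySet X) :
    F.fuzzify Q (appendOne (appendOne p (F.compl a)) (F.compl b)) =
      F.fuzzify Q (appendOne (appendOne p a) b) := by
  let D : SemiFuzzyQuantifier X (n + 2) := fun S => F.neg (Q (mapLast (fun T => Tᶜ) S))
  let D' : SemiFuzzyQuantifier X (n + 2) := fun S => D (swapLast S)
  let D'' : SemiFuzzyQuantifier X (n + 2) := fun S => F.neg (D' (mapLast (fun T => Tᶜ) S))
  have e : Q = fun S => D'' (swapLast S) := by
    funext S
    obtain ⟨p, S, T, rfl⟩ := exists_appendOne_appendOne S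
    simp only [D, D', D'', swapLast_appendOne, mapLast_appendOne, hQ, hF.neg_neg]
  conv_rhs => rw [e]
  rw [hF.fuzzify_swapLast D'', swapLast_appendOne, hF.fuzzify_dual D', hF.fuzzify_swapLast D,
    swapLast_appendOne, hF.fuzzify_dual Q, hF.neg_neg]

/-- Compatibility with the insertion of a vacuous last argument. -/
theorem fuzzify_dropLast (hF : F.IsDFS) (Q : SemiFuzzyQuantifier X (n + 1))
    (A : Fin (n + 1) → FuzzySet X) (b : FuzzySet X) :
    F.fuzzify (fun S => Q (dropLast S)) (appendOne A b) = F.fuzzify Q A := by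
  -- Two vacuous arguments are needed: `fuzzify_compl_compl` then equates the values at `(⊥, ⊥)` and
  -- `(⊤, ⊤)`, and antitonicity in either argument squeezes the value at `(b, ⊥)` between them.
  let Q' : SemiFuzzyQuantifier X (n + 3) := fun S => Q (dropLast (dropLast S))
  have hb : ∀ b, F.fuzzify Q' (appendOne (appendOne A b) ⊥) =
      F.fuzzify (fun S => Q (dropLast S)) (appendOne A b) := fun b =>
    hF.fuzzify_dropLast_bot (fun S => Q (dropLast S)) _
  have hswap : ∀ b c, F.fuzzify Q' (appendOne (appendOne A b) c) =
      F.fuzzify Q' (appendOne (appendOne A c) b) := fun b c => by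
    rw [← swapLast_appendOne, ← hF.fuzzify_swapLast]
    congr 1
    funext S
    obtain ⟨p, S, T, rfl⟩ := exists_appendOne_appendOne S
    simp [Q']
  have hmono : ∀ (p : Fin (n + 2) → FuzzySet X) {a b : FuzzySet X}, a ≤ b →
      F.fuzzify Q' (appendOne p b) ≤ F.fuzzify Q' (appendOne p a) := fun p a b hab =>
    hF.fuzzify_antitone Q' (fun S T _ => by
      obtain ⟨p, a, rfl⟩ := exists_appendOne S
      simp [Q']) p hab
  have htop := hF.fuzzify_compl_compl Q' (fun p S T => by simp [Q']) A ⊥ ⊥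
  rw [hF.compl_bot] at htop
  rw [← hF.fuzzify_dropLast_bot Q A, ← hb, ← hb]
  refine le_antisymm ?_ ?_
  · rw [hswap b]
    exact hmono _ bot_le
  · rw [← htop, hswap b]
    exact (hmono _ le_top).trans ((hswap _ _).trans_le (hmono _ bot_le) |>.trans (hswap _ _).le)

/-! ### Negation and implication -/

/-- Compatibility with external negation. -/
theorem fuzzify_neg (hF : F.IsDFS) (Q : SemiFuzzyQuantifier X (n + 1))
    (A : Fin (n + 1) → FuzzySet X) :
    F.fuzzify (fun S => F.neg (Q S)) A = F.neg (F.fuzzify Q A) := by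
  -- The vacuous argument is filled with `⊥` on one side and with its complement on the other, so
  -- that dualization connects the two and its internal complement has no effect.
  rw [← hF.fuzzify_dropLast (fun S => F.neg (Q S)) A ⊥,
    ← hF.fuzzify_dropLast Q A (F.compl ⊥), ← hF.fuzzify_dual]
  congr 1
  funext S
  obtain ⟨p, S, rfl⟩ := exists_appendOne S
  simp

/-- Compatibility with internal complementation of the last argument. -/
theorem fuzzify_compl_last (hF : F.IsDFS) (Q : SemiFuzzyQuantifier X (n + 1))
    (p : Fin n → FuzzySet X) (a : FuzzySet X) :
    F.fuzzify (fun S => Q (mapLast (fun T => Tᶜ) S)) (appendOne p a) =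
      F.fuzzify Q (appendOne p (F.compl a)) := by
  rw [← hF.neg_neg (F.fuzzify Q _), ← hF.fuzzify_dual, ← hF.fuzzify_neg]
  simp only [hF.neg_neg]

/-- The argument to be complemented is next to last, so it is exchanged into last position,
complemented, and exchanged back before the join. -/
theorem fuzzify_implicative_eq_union (hF : F.IsDFS) (Q : SemiFuzzyQuantifier X (n + 1))
    (p : Fin n → FuzzySet X) (a b : FuzzySet X) :
    F.fuzzify Q.implicative (appendOne (appendOne p a) b) =
      F.fuzzify Q (appendOne p (F.union (F.compl a) b)) := by
  let J : SemiFuzzyQuantifier X (n + 2) := fun S => Q (mergeLast (fun T U => T ∪ U) S)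
  let J' : SemiFuzzyQuantifier X (n + 2) := fun S => J (swapLast S)
  let J'' : SemiFuzzyQuantifier X (n + 2) := fun S => J' (mapLast (fun T => Tᶜ) S)
  have e : Q.implicative = fun S => J'' (swapLast S) := by
    funext S
    obtain ⟨p, S, T, rfl⟩ := exists_appendOne_appendOne S
    simp only [J, J', J'', SemiFuzzyQuantifier.implicative, swapLast_appendOne, mapLast_appendOne,
      mergeLast_appendOne]
  rw [e, hF.fuzzify_swapLast J'', swapLast_appendOne, hF.fuzzify_compl_last J',
    hF.fuzzify_swapLast J, swapLast_appendOne, hF.internal_joins Q]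
  simp only [mergeLast_appendOne]

/-- The induced implication is the material one. -/
theorem imp_eq_disj_neg (hF : F.IsDFS) (x y : I) : F.imp x y = F.disj (F.neg x) y := by
  let P : SemiFuzzyQuantifier PUnit.{u + 1} 1 := fun S => truthValue (PUnit.unit ∈ S 0)
  let K : SemiFuzzyQuantifier (ULift.{u} (Fin 2)) 1 :=
    truthQuantifier.{u} fun p : Fin 2 → Prop => truthValue (p 0 → p 1)
  let f : PUnit.{u + 1} ⊕ PUnit.{u + 1} → ULift.{u} (Fin 2) :=
    Sum.elim (fun _ => ULift.up 0) (fun _ => ULift.up 1)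
  have hf : f.Injective := by rintro (_ | _) (_ | _) h <;> simp_all [f]
  have h0 (S T : Set PUnit.{u + 1}) :
      ULift.up 0 ∈ f '' (Sum.inl '' S ∪ Sum.inr '' T) ↔ PUnit.unit ∈ S := by
    simp [f, Unique.exists_iff]
  have h1 (S T : Set PUnit.{u + 1}) :
      ULift.up 1 ∈ f '' (Sum.inl '' S ∪ Sum.inr '' T) ↔ PUnit.unit ∈ T := by
    simp [f, Unique.exists_iff]
  -- The quantifier `P.implicative` on a point is also the truth quantifier `K` of implication, read
  -- through the identification `f` of two points with `Fin 2`. One reading gives `F.disj (F.neg x)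
  -- y`, the other `F.imp x y`.
  have h := hF.fuzzify_sum (fun U => K (fun i => f '' U i)) P.implicative (fun p S T => by
    simp only [SemiFuzzyQuantifier.implicative, mergeLast_appendOne]
    simp only [P, K, truthQuantifier, appendOne_zero, h0, h1, Set.mem_union, Set.mem_compl_iff,
      imp_iff_not_or])
    Fin.elim0 (fun _ => x) (fun _ => y)
  rw [hF.fuzzify_implicative_eq_union, hF.fuzzify_projection, hF.fuzzify_image, appendOne_zero,
    appendOne_zero] at h
  refine Eq.trans ?_ h.symm
  rw [imp, inducedTruth]
  congr 1
  funext _ k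
  obtain ⟨k⟩ := k
  fin_cases k
  · exact (hF.image_apply_of_injective hf (Sum.elim (fun _ => x) fun _ => y)
      (Sum.inl PUnit.unit)).symm
  · exact (hF.image_apply_of_injective hf (Sum.elim (fun _ => x) fun _ => y)
      (Sum.inr PUnit.unit)).symm

theorem fuzzify_implicative (hF : F.IsDFS) (Q : SemiFuzzyQuantifier X (n + 1)) :
    F.fuzzify Q.implicative = FuzzyQuantifier.implicative F (F.fuzzify Q) := by
  funext A
  obtain ⟨p, a, b, rfl⟩ := exists_appendOne_appendOne A
  have h : F.impSet a b = F.union (F.compl a) b := funext fun x => hF.imp_eq_disj_neg _ _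
  rw [hF.fuzzify_implicative_eq_union, FuzzyQuantifier.implicative, mergeLast_appendOne, h]

end QFM.IsDFS

theorem mainTheorem10 (F : QFM.{u}) (hF : F.IsDFS) :
    (∀ (X : Type u) [Finite X] [Nonempty X] (n : ℕ) (Q : SemiFuzzyQuantifier X (n + 1)),
      F.fuzzify Q.implicative = FuzzyQuantifier.implicative F (F.fuzzify Q)) ∧
    (∀ (X : Type u) [Finite X] [Nonempty X] (Λ : I → I), IsRIM Λ →
      ∀ A B : FuzzySet X,
        F.fuzzify (implicativeProportional X Λ) ![A, B] =
          F.fuzzify (unaryProportional X Λ) ![F.impSet A B]) := by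
  refine ⟨fun X _ _ n Q => hF.fuzzify_implicative Q, fun X _ _ Λ _ A B => ?_⟩
  have e : implicativeProportional X Λ = (unaryProportional X Λ).implicative := rfl
  rw [e, hF.fuzzify_implicative, FuzzyQuantifier.implicative,
    ← appendOne_appendOne_zero Fin.elim0 A B, mergeLast_appendOne, appendOne_zero]
  congr 1
  funext i
  match i with
  | 0 => rfl
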